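/- **Setting.** $N$ processes have distinct positions in $\mathbb R^3$, known to all of them. They communicate synchronously by oral messages: in each round every process may send a message to every process, and a recipient knows the sender. Let $\ell>0$ and $M\ge 1$. There are $M$ closed fault areas $F$ of a common known shape and size (a cube of side $\ell$ or a solid sphere of diameter $\ell$) at positions unknown to the processes. Any process covered by a fault area may be Byzantine (it may send arbitrary messages); all other processes are correct. Let $f$ be the number of covered processes. A protocol *solves geoconsensus* if in every computation, for all binary inputs, no two correct processes decide differently (agreement), if all correct inputs are equal to $v$ then every correct process decides $v$ (validity), and every correct process eventually decides (termination); decisions are irrevocable. **Covers.** GCUBE covers the processes by axis-aligned closed cubes of side $\ell$. It divides the processes greedily along the $z$-axis into slabs of depth $\ell$ (a slab starts at the least $z$-coordinate not yet covered), each slab greedily along the $y$-axis into cuboids of height $\ell$, and covers each cuboid greedily along the $x$-axis by cubes. GSPHERE replaces each cube of GCUBE by at most eight spheres of diameter $\ell$ that together cover the processes in the cube; each process of the cube is assigned to the first of these spheres that covers it, and spheres to which no process is assigned are dropped. $\mathcal A$ denotes the resulting set of cubes, respectively of spheres. **GENERIC** with overlap bound $n$: the leader of an area $A\in\mathcal A$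 is the process with the least $y$-coordinate (ties are broken by $x$, then by $z$) among those in the cube $A$, respectively among those assigned to the sphere $A$. Put $t=nM$. In rounds $1,\dots,t+1$ the leaders run among themselves the oral-messages consensus algorithm of Pease, Shostak and Lamport for $t$ faults (relaying everything heard in the previous round, then deciding by recursive majority); in round $t+2$ they broadcast their decision. Every other process adopts a decision once it has received it from at least $2t+1$ leaders. **Theorem.** For every set of $N$ processes in $\mathbb R^3$, every $M\ge 1$ and every $\ell>0$: 1. If every $F$ is a cube of side $\ell$ in arbitrary orientation, the cover areas $A$ are the cubes of GCUBE, and $|\mathcal A|\ge 82M$, then $f\le N-55M$ and GENERIC with $n=27$ solves geoconsensus, for all placements of the $M$ fault areas. 2. If every $F$ is an axis-aligned cube of side $\ell$, the cover areas $A$ are the cubes of GCUBE, and $|\mathcal A|\ge 25M$, then $f\le N-17M$ and GENERIC with $n=8$ solves geoconsensus, for all placements of the $M$ fault areas. 3. If every $F$ is a solid sphere of diameter $\ell$, the cover areas $A$ are the spheres of diameter $\ell$ of any GSPHERE cover, and $|\mathcal A|\ge 325M$, then $f\le N-217M$ and GENERIC with $n=108$ solves geoconsensus, for all placements of the $M$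 fault areas. In each case every correct process decides within $nM+2$ rounds. -/

import Mathlib

open Finset

/-! ### Synchronous message passing with Byzantine processes -/

/-- A deterministic synchronous protocol. In every round each process sends one message to each
process, receives the messages addressed to it, and updates its state. -/
structure SyncProtocol (P Msg State : Type) where
  start : P → Bool → State
  send : P → State → P → Msg
  step : P → State → (P → Msg) → State
  output : State → Option Bool

/-- `state r p` is the state of `p` after `r` rounds, and `msg r p q` is the message that `p` sends
to `q` in the round that follows. The processes outside `faulty` obey the protocol; the messages
of a faulty process are arbitrary and may differ from one recipient to another, but the recipient
knows who sent them. -/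
structure IsComputation {P Msg State : Type} (A : SyncProtocol P Msg State) (faulty : Finset P)
    (input : P → Bool) (state : ℕ → P → State) (msg : ℕ → P → P → Msg) : Prop where
  start_eq : ∀ p, p ∉ faulty → state 0 p = A.start p (input p)
  send_eq : ∀ r p, p ∉ faulty → ∀ q, msg r p q = A.send p (state r p) q
  step_eq : ∀ r p, p ∉ faulty → state (r + 1) p = A.step p (state r p) (fun q => msg r q p)

/-- The properties of binary consensus for a family of outputs over time (`out r p` is the output of
`p` after `r` rounds), where every correct process has to decide within `T` rounds. -/
structure IsConsensus {P : Type} (faulty : Finset P) (input : P → Bool)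
    (out : ℕ → P → Option Bool) (T : ℕ) : Prop where
  irrevocable : ∀ p, p ∉ faulty → ∀ r s v, r ≤ s → out r p = some v → out s p = some v
  agreement : ∀ p q, p ∉ faulty → q ∉ faulty → ∀ r s v w,
    out r p = some v → out s q = some w → v = w
  validity : ∀ v, (∀ p, p ∉ faulty → input p = v) → ∀ p, p ∉ faulty → ∃ r, out r p = some v
  termination : ∀ p, p ∉ faulty → ∃ r, r ≤ T ∧ ∃ v, out r p = some v

/-! ### The algorithm, for a given set of leaders -/

/-- Messages: nothing, the relayed contents of an information tree, or an announced decision.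
In a tree, the label `[j₁, j₂, …, jₖ]` stands for
"`j₁` said that `j₂` said that … that `jₖ` said that its input is". -/
inductive GMsg (P : Type) where
  | silent : GMsg P
  | relay (tree : List P → Bool) : GMsg P
  | announce (v : Bool) : GMsg P

/-- What a message claims about a label; a message of the wrong kind counts as `false`. -/
def GMsg.claim {P : Type} : GMsg P → List P → Bool
  | .relay tree, x => tree x
  | _, _ => false

/-- The decision that a message announces, if any. -/
def GMsg.announced {P : Type} : GMsg P → Option Bool
  | .announce v => some v
  | _ => none

structure GState (P : Type) where
  /-- number of completed rounds -/
  round : ℕ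
  /-- information tree (used by leaders) -/
  tree : List P → Bool
  /-- the leaders from which a value has been received as their decision (used by the others) -/
  votes : Bool → Finset P
  decision : Option Bool

/-- Store in the tree what has been received in round `r + 1`: each sender `j` tells the values of
the labels of length `r`. -/
def recordRound {P : Type} (r : ℕ) (m : P → GMsg P) (tree : List P → Bool) : List P → Bool
  | [] => tree []
  | j :: x => if x.length = r then (m j).claim x else tree (j :: x)

/-- The value `true` if it has a strict majority on `s`, and `false` otherwise. -/
def majority {P : Type} (s : Finset P) (g : P → Bool) : Bool :=
  decide (s.card < 2 * (s.filter fun j => g j = true).card)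

/-- Recursive majority vote on the subtree of height `k` below the label `x`; labels consist of
distinct members of `L`. -/
def resolve {P : Type} [DecidableEq P] (L : Finset P) (tree : List P → Bool) : ℕ → List P → Bool
  | 0, x => tree x
  | k + 1, x => majority (L.filter fun j => j ∉ x) (fun j => resolve L tree k (j :: x))

/-- GENERIC with leader set `L`, designed for at most `t` faulty leaders. In the first `t + 1`
rounds the leaders run among themselves the oral-messages algorithm of Pease, Shostak and Lamport
for `t` faults: they relay everything they heard in the previous round, and after `t + 1` rounds
each of them decides by recursive majority. In the next round the leaders broadcast their decision.
Any other process waits until it has received one and the same decision from at least `2 * t + 1`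
leaders, and adopts it. -/
def generic {P : Type} [DecidableEq P] (L : Finset P) (t : ℕ) :
    SyncProtocol P (GMsg P) (GState P) where
  start _ v :=
    { round := 0
      tree := fun x => match x with
        | [] => v
        | _ :: _ => false
      votes := fun _ => ∅
      decision := none }
  send p s q :=
    if p ∈ L then
      if s.round ≤ t then
        if q ∈ L then .relay s.tree else .silent
      else if s.round = t + 1 then
        match s.decision with
        | some v => .announce v
        | none => .silent
      else .silent
    else .silent
  step p s m :=
    if p ∈ L then
      let tree' := if s.round ≤ t then recordRound s.round m s.tree else s.tree
      { round := s.round + 1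
        tree := tree'
        votes := s.votes
        decision := if s.round = t then some (resolve L tree' (t + 1) []) else s.decision }
    else
      let votes' := fun v => s.votes v ∪ L.filter fun j => (m j).announced = some v
      { round := s.round + 1
        tree := s.tree
        votes := votes'
        decision := match s.decision with
          | some v => some v
          | none =>
            if 2 * t + 1 ≤ (votes' true).card then some true
            else if 2 * t + 1 ≤ (votes' false).card then some false
            else none }
  output s := s.decision

/-! ### Geometry -/

/-- Euclidean 3-space; the coordinates `x`, `y`, `z` have the indices `0`, `1`, `2`. -/
abbrev Space3 := EuclideanSpace ℝ (Fin 3)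

/-- The closed axis-aligned cube of side `ℓ` with least corner `c`. -/
def axisCube (ℓ : ℝ) (c : Space3) : Set Space3 := {q | ∀ i, c i ≤ q i ∧ q i ≤ c i + ℓ}

def IsAxisCube (ℓ : ℝ) (F : Set Space3) : Prop := ∃ c, F = axisCube ℓ c

/-- A closed solid cube of side `ℓ` in any position and orientation. -/
def IsCube (ℓ : ℝ) (F : Set Space3) : Prop := ∃ g : Space3 ≃ᵢ Space3, F = g '' axisCube ℓ 0

/-- A closed solid sphere of diameter `ℓ`. -/
def IsSolidSphere (ℓ : ℝ) (F : Set Space3) : Prop := ∃ c, F = Metric.closedBall c (ℓ / 2)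

noncomputable section

/-- Greedy slabs of thickness `ℓ` on a line, with at most `n` steps: the first slab starts at the
least point, the next one at the least point that is not covered yet, and so on. The value is the
set of the starting points. -/
def greedyAux (ℓ : ℝ) : ℕ → Finset ℝ → Finset ℝ
  | 0, _ => ∅
  | n + 1, S =>
    if h : S.Nonempty then
      insert (S.min' h) (greedyAux ℓ n (S.filter fun x => S.min' h + ℓ < x))
    else ∅

def greedyStarts (ℓ : ℝ) (S : Finset ℝ) : Finset ℝ := greedyAux ℓ S.card S

open Classical in
/-- The greedy cube cover GCUBE, as the set of the least corners of its cubes: the processes are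
divided into slabs of depth `ℓ` along the `z`-axis, each slab into cuboids of height `ℓ` along the
`y`-axis, and each cuboid is covered by cubes of side `ℓ` along the `x`-axis. -/
def gcube {N : ℕ} (ℓ : ℝ) (pos : Fin N → Space3) : Finset Space3 :=
  (greedyStarts ℓ (univ.image fun p => pos p 2)).biUnion fun c =>
    let slab : Finset (Fin N) := univ.filter fun p => c ≤ pos p 2 ∧ pos p 2 ≤ c + ℓ
    (greedyStarts ℓ (slab.image fun p => pos p 1)).biUnion fun b =>
      let cuboid : Finset (Fin N) := slab.filter fun p => b ≤ pos p 1 ∧ pos p 1 ≤ b + ℓ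
      (greedyStarts ℓ (cuboid.image fun p => pos p 0)).image fun a => !₂[a, b, c]

/-- `centers c` lists the centers of the spheres of diameter `ℓ` that replace the cube with least
corner `c` (a center may be repeated, so this means at most eight spheres). They have to cover the
processes that the cube covers. -/
def IsSphereRefinement {N : ℕ} (ℓ : ℝ) (pos : Fin N → Space3)
    (centers : Space3 → Fin 8 → Space3) : Prop :=
  ∀ c ∈ gcube ℓ pos, ∀ p, pos p ∈ axisCube ℓ c →
    ∃ i, pos p ∈ Metric.closedBall (centers c i) (ℓ / 2)

/-- The part of the cube with least corner `c` that is covered by its `i`-th sphere, and not by an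
earlier one. -/
def sphereCell (ℓ : ℝ) (centers : Space3 → Fin 8 → Space3) (a : Space3 × Fin 8) : Set Space3 :=
  {q | q ∈ axisCube ℓ a.1 ∧ q ∈ Metric.closedBall (centers a.1 a.2) (ℓ / 2) ∧
    ∀ j, j < a.2 → q ∉ Metric.closedBall (centers a.1 j) (ℓ / 2)}

open Classical in
/-- The sphere cover GSPHERE that refines the greedy cube cover: the pair `(c, i)` stands for the
`i`-th sphere of the cube `c`. Spheres that have no process left to cover are dropped. -/
def gsphere {N : ℕ} (ℓ : ℝ) (pos : Fin N → Space3) (centers : Space3 → Fin 8 → Space3) :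
    Finset (Space3 × Fin 8) :=
  (gcube ℓ pos ×ˢ univ).filter fun a => ∃ p, pos p ∈ sphereCell ℓ centers a

/-- Lexicographic order by `y`, then `x`, then `z`. -/
def leaderLE (u v : Space3) : Prop :=
  u 1 < v 1 ∨ (u 1 = v 1 ∧ (u 0 < v 0 ∨ (u 0 = v 0 ∧ u 2 ≤ v 2)))

/-- `p` is the leader of the region `A`: the first process in it. -/
def IsLeader {N : ℕ} (pos : Fin N → Space3) (A : Set Space3) (p : Fin N) : Prop :=
  pos p ∈ A ∧ ∀ q, pos q ∈ A → leaderLE (pos p) (pos q)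

open Classical in
/-- The leaders of the areas of a cover, one for each area. -/
def leaders {ι : Type} {N : ℕ} (pos : Fin N → Space3) (cover : Finset ι) (region : ι → Set Space3) :
    Finset (Fin N) :=
  univ.filter fun p => ∃ a ∈ cover, IsLeader pos (region a) p

/-- GENERIC with cubic covers of side `ℓ`, for `M` fault areas each of which is taken to meet at most
`n` areas of the cover. -/
def genericCube {N : ℕ} (ℓ : ℝ) (pos : Fin N → Space3) (n M : ℕ) :
    SyncProtocol (Fin N) (GMsg (Fin N)) (GState (Fin N)) :=
  generic (leaders pos (gcube ℓ pos) (axisCube ℓ)) (n * M)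

/-- GENERIC with spherical covers of diameter `ℓ`, for `M` fault areas each of which is taken to meet at most
`n` areas of the cover. -/
def genericSphere {N : ℕ} (ℓ : ℝ) (pos : Fin N → Space3) (centers : Space3 → Fin 8 → Space3)
    (n M : ℕ) : SyncProtocol (Fin N) (GMsg (Fin N)) (GState (Fin N)) :=
  generic (leaders pos (gsphere ℓ pos centers) (sphereCell ℓ centers)) (n * M)

open Classical in
/-- The processes that lie in the interior or on the boundary of some fault area. -/
def coveredProcesses {N M : ℕ} (pos : Fin N → Space3) (F : Fin M → Set Space3) :
    Finset (Fin N) :=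
  univ.filter fun p => ∃ i, pos p ∈ F i

/-- The protocol solves geoconsensus for the fault areas `F`, within `T` rounds: whichever covered
processes are Byzantine, whatever they do, and whatever the inputs are, the consensus properties
hold. -/
def SolvesGeoconsensus {N M : ℕ} {Msg State : Type} (A : SyncProtocol (Fin N) Msg State)
    (pos : Fin N → Space3) (F : Fin M → Set Space3) (T : ℕ) : Prop :=
  ∀ faulty : Finset (Fin N), faulty ⊆ coveredProcesses pos F →
    ∀ (input : Fin N → Bool) (state : ℕ → Fin N → State) (msg : ℕ → Fin N → Fin N → Msg),
      IsComputation A faulty input state msg →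
        IsConsensus faulty input (fun r p => A.output (state r p)) T

end

/-! ### Recursive majority -/

/-! The geometry enters only through the number of faulty leaders. If every fault area meets at most
`n` cover areas, and no process belongs to two areas, then at most `t = n * M` leaders are covered
(`card_covered_leaders_le`), while there are as many leaders as areas. So `3 * t + 1` areas reduce
the problem to classical Byzantine agreement among the leaders.

Agreement among leaders rests on two facts about the information tree. Below a correct node, the
correct children are a majority and all repeat what that node's sender relayed, so recursive
majority recovers this value (`resolve_cons_of_correct`). Along a path of faulty labels the depth is
at most `t`, so every path of length `t + 1` meets a correct label, where all correct leaders agree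
(`resolve_agreement`). The other processes can trust `2 * t + 1` equal announcements: that many
correct leaders exist, and the faulty ones alone cannot reach the threshold.

The overlap bound comes from greedy starting points being more than `ℓ` apart: a set of extent at
most `k * ℓ` meets at most `k + 1` intervals on a line (`card_le_of_separated`), hence at most `(k +
1) ^ 3` cubes. A rotated cube has diameter `√3 * ℓ ≤ 2 * ℓ`, so `k = 2`; an aligned cube or a sphere
has `k = 1`. The bound on `f` is inclusion-exclusion for leaders and covered processes. -/

theorem majority_eq_of_card_lt {P : Type} {s : Finset P} {g : P → Bool} {v : Bool}
    (h : 2 * (s.filter fun j => g j ≠ v).card < s.card) : majority s g = v := by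
  have hc := Finset.card_filter_add_card_filter_not (s := s) (fun j => g j = true)
  cases v
  · simp only [ne_eq, Bool.not_eq_false] at h
    simp only [majority, decide_eq_false_iff_not]
    omega
  · simp only [ne_eq] at h
    simp only [majority, decide_eq_true_eq]
    omega

theorem majority_congr {P : Type} {s : Finset P} {g g' : P → Bool} (h : ∀ j ∈ s, g j = g' j) :
    majority s g = majority s g' := by
  have : (s.filter fun j => g j = true) = s.filter fun j => g' j = true :=
    Finset.filter_congr fun j hj => by rw [h j hj]
  rw [majority, majority, this]

/-- Excluding the at most `t` labels in `x` leaves at least `2 * t + 1` voters, of whom at most `t`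
are faulty and can dissent. -/
theorem majority_eq_of_correct {P : Type} [DecidableEq P] {L faulty : Finset P} {t : ℕ}
    (hf : (L.filter (· ∈ faulty)).card ≤ t) (hL : 3 * t + 1 ≤ L.card) {x : List P}
    (hx : x.length ≤ t) {g : P → Bool} {v : Bool} (h : ∀ j ∈ L, j ∉ faulty → g j = v) :
    majority (L.filter fun j => j ∉ x) g = v := by
  apply majority_eq_of_card_lt
  have h1 : ((L.filter fun j => j ∉ x).filter fun j => g j ≠ v).card ≤ t := by
    refine (Finset.card_le_card fun j hj => ?_).trans hf
    simp only [Finset.mem_filter] at hj ⊢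
    exact ⟨hj.1.1, by_contra fun hj' => hj.2 (h j hj.1.1 hj')⟩
  have h2 : L.card - x.toFinset.card ≤ (L.filter fun j => j ∉ x).card := by
    have : (L.filter fun j => j ∉ x) = L \ x.toFinset := by
      ext j; simp
    rw [this]
    exact Finset.le_card_sdiff _ _
  have h3 := x.toFinset_card_le
  omega

/-- The value of a correct node of the information tree is what its sender relayed. -/
theorem resolve_cons_of_correct {P : Type} [DecidableEq P] {L faulty : Finset P} {t : ℕ}
    (hf : (L.filter (· ∈ faulty)).card ≤ t) (hL : 3 * t + 1 ≤ L.card) {T : P → List P → Bool}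
    (hT : ∀ p ∈ L, p ∉ faulty → ∀ j ∈ L, j ∉ faulty → ∀ x : List P, x.length ≤ t →
      T p (j :: x) = T j x) {p : P} (hp : p ∈ L) (hpf : p ∉ faulty) :
    ∀ (k : ℕ) (x : List P), x.length + k = t → ∀ j ∈ L, j ∉ faulty →
      resolve L (T p) k (j :: x) = T j x
  | 0, x, hx, j, hj, hjf => hT p hp hpf j hj hjf x (by omega)
  | k + 1, x, hx, j, hj, hjf => by
    rw [resolve]
    -- A correct child `i` resolves to what `i` holds for `j :: x`, and this is what `j` itself told
    -- `i` about `x`.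
    refine majority_eq_of_correct hf hL (by simp only [List.length_cons]; omega) fun i hi hif => ?_
    rw [resolve_cons_of_correct hf hL hT hp hpf k (j :: x)
      (by simp only [List.length_cons]; omega) i hi hif]
    exact hT i hi hif j hj hjf x (by omega)

/-- The induction descends only through faulty labels, since below a correct child both sides
resolve to what that child relayed. The leaf case is void: a leaf would list `t + 1` distinct faulty
leaders. -/
theorem resolve_agreement {P : Type} [DecidableEq P] {L faulty : Finset P} {t : ℕ}
    (hf : (L.filter (· ∈ faulty)).card ≤ t) (hL : 3 * t + 1 ≤ L.card) {T : P → List P → Bool}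
    (hT : ∀ p ∈ L, p ∉ faulty → ∀ j ∈ L, j ∉ faulty → ∀ x : List P, x.length ≤ t →
      T p (j :: x) = T j x) {p q : P} (hp : p ∈ L) (hpf : p ∉ faulty) (hq : q ∈ L)
    (hqf : q ∉ faulty) :
    ∀ (k : ℕ) (x : List P), x.length + k = t + 1 → x.Nodup → (∀ j ∈ x, j ∈ L ∧ j ∈ faulty) →
      resolve L (T p) k x = resolve L (T q) k x
  | 0, x, hx, hnd, hxf => by
    have h1 : x.toFinset.card = x.length := List.toFinset_card_of_nodup hnd
    have h2 : x.toFinset ⊆ L.filter (· ∈ faulty) := fun j hj => by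
      simpa using hxf j (by simpa using hj)
    have h3 := Finset.card_le_card h2
    omega
  | k + 1, x, hx, hnd, hxf => by
    rw [resolve, resolve]
    refine majority_congr fun j hj => ?_
    obtain ⟨hjL, hjx⟩ := Finset.mem_filter.1 hj
    by_cases hjf : j ∈ faulty
    · refine resolve_agreement hf hL hT hp hpf hq hqf k (j :: x)
        (by simp only [List.length_cons]; omega) (List.nodup_cons.2 ⟨hjx, hnd⟩) ?_
      intro i hi
      rcases List.mem_cons.1 hi with rfl | hi
      exacts [⟨hjL, hjf⟩, hxf i hi]
    · rw [resolve_cons_of_correct hf hL hT hp hpf k x (by omega) j hjL hjf,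
        resolve_cons_of_correct hf hL hT hq hqf k x (by omega) j hjL hjf]

/-! ### Computations of GENERIC -/

section Computation

variable {P : Type} [DecidableEq P] {L faulty : Finset P} {t : ℕ} {input : P → Bool}
  {state : ℕ → P → GState P} {msg : ℕ → P → P → GMsg P}

theorem generic_round (hc : IsComputation (generic L t) faulty input state msg) {p : P}
    (hp : p ∉ faulty) (r : ℕ) : (state r p).round = r := by
  induction r with
  | zero => rw [hc.start_eq p hp]; rfl
  | succ r ih =>
    rw [hc.step_eq r p hp]
    by_cases hpL : p ∈ L <;> simp [generic, hpL, ih]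

theorem generic_tree_succ (hc : IsComputation (generic L t) faulty input state msg) {p : P}
    (hp : p ∉ faulty) (hpL : p ∈ L) {r : ℕ} (hr : r ≤ t) :
    (state (r + 1) p).tree = recordRound r (fun q => msg r q p) (state r p).tree := by
  rw [hc.step_eq r p hp]
  simp [generic, hpL, generic_round hc hp, hr]

/-- Each round writes only labels one longer than those of the round before, so a label is final
once the rounds completed reach its length. -/
theorem generic_tree_stable (hc : IsComputation (generic L t) faulty input state msg) {p : P}
    (hp : p ∉ faulty) (hpL : p ∈ L) {r : ℕ} {x : List P} (hx : x.length ≤ r) (hr : r ≤ t + 1) :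
    (state (t + 1) p).tree x = (state r p).tree x := by
  refine Nat.le_induction (P := fun s _ => s ≤ t + 1 → (state s p).tree x = (state r p).tree x)
    (fun _ => rfl) (fun s hs ih hst => ?_) (t + 1) hr le_rfl
  rw [generic_tree_succ hc hp hpL (by omega), ← ih (by omega)]
  cases x with
  | nil => rfl
  | cons j x =>
    rw [recordRound, if_neg]
    simp only [List.length_cons] at hx
    omega

/-- Stability allows the sender's tree at the moment of sending to be replaced by its final tree.
This yields the time-free hypothesis `hT` of the lemmas on recursive majority. -/
theorem generic_tree_cons (hc : IsComputation (generic L t) faulty input state msg) {p j : P}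
    (hp : p ∉ faulty) (hpL : p ∈ L) (hj : j ∉ faulty) (hjL : j ∈ L) {x : List P}
    (hx : x.length ≤ t) : (state (t + 1) p).tree (j :: x) = (state (t + 1) j).tree x := by
  rw [generic_tree_stable hc hp hpL (r := x.length + 1) (by simp) (by omega),
    generic_tree_succ hc hp hpL hx, recordRound, if_pos rfl, hc.send_eq _ j hj,
    generic_tree_stable hc hj hjL (r := x.length) le_rfl (by omega)]
  simp [generic, hpL, hjL, generic_round hc hj, hx, GMsg.claim]

theorem generic_tree_nil (hc : IsComputation (generic L t) faulty input state msg) {p : P}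
    (hp : p ∉ faulty) (hpL : p ∈ L) : (state (t + 1) p).tree [] = input p := by
  rw [generic_tree_stable hc hp hpL (r := 0) le_rfl (by omega), hc.start_eq p hp]
  rfl

theorem generic_leader_decision (hc : IsComputation (generic L t) faulty input state msg) {p : P}
    (hp : p ∉ faulty) (hpL : p ∈ L) (r : ℕ) :
    (state r p).decision =
      if r ≤ t then none else some (resolve L (state (t + 1) p).tree (t + 1) []) := by
  induction r with
  | zero => rw [hc.start_eq p hp]; rfl
  | succ r ih =>
    rcases eq_or_ne r t with rfl | hr
    · rw [generic_tree_succ hc hp hpL le_rfl, hc.step_eq r p hp]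
      simp [generic, hpL, generic_round hc hp]
    · have h : (state (r + 1) p).decision = (state r p).decision := by
        rw [hc.step_eq r p hp]
        simp [generic, hpL, generic_round hc hp, hr]
      rw [h, ih]
      have : r ≤ t ↔ r + 1 ≤ t := by omega
      simp only [this]

theorem generic_announced (hc : IsComputation (generic L t) faulty input state msg) {j : P}
    (hj : j ∉ faulty) (hjL : j ∈ L) (r : ℕ) (p : P) :
    (msg r j p).announced =
      if r = t + 1 then some (resolve L (state (t + 1) j).tree (t + 1) []) else none := by
  rw [hc.send_eq r j hj]
  have hd := generic_leader_decision hc hj hjL r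
  by_cases h1 : r ≤ t
  · have h2 : r ≠ t + 1 := by omega
    by_cases hpL : p ∈ L <;>
      simp [generic, hjL, generic_round hc hj, h1, h2, hpL, GMsg.announced]
  · by_cases h2 : r = t + 1
    · subst h2
      rw [if_neg h1] at hd
      simp [generic, hjL, generic_round hc hj, hd, GMsg.announced]
    · simp [generic, hjL, generic_round hc hj, h1, h2, GMsg.announced]

theorem generic_votes_succ (hc : IsComputation (generic L t) faulty input state msg) {p : P}
    (hp : p ∉ faulty) (hpL : p ∉ L) (r : ℕ) (v : Bool) :
    (state (r + 1) p).votes v =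
      (state r p).votes v ∪ L.filter fun j => (msg r j p).announced = some v := by
  rw [hc.step_eq r p hp]
  simp [generic, hpL]

theorem generic_decision_succ (hc : IsComputation (generic L t) faulty input state msg) {p : P}
    (hp : p ∉ faulty) (hpL : p ∉ L) (r : ℕ) :
    (state (r + 1) p).decision =
      match (state r p).decision with
      | some v => some v
      | none =>
        if 2 * t + 1 ≤ ((state (r + 1) p).votes true).card then some true
        else if 2 * t + 1 ≤ ((state (r + 1) p).votes false).card then some false
        else none := by
  rw [generic_votes_succ hc hp hpL, generic_votes_succ hc hp hpL, hc.step_eq r p hp]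
  simp only [generic, hpL, if_false]

theorem generic_irrevocable (hc : IsComputation (generic L t) faulty input state msg) {p : P}
    (hp : p ∉ faulty) {r s : ℕ} {v : Bool} (hrs : r ≤ s) (h : (state r p).decision = some v) :
    (state s p).decision = some v := by
  by_cases hpL : p ∈ L
  · rw [generic_leader_decision hc hp hpL] at h ⊢
    by_cases hr : r ≤ t
    · simp [hr] at h
    · rw [if_neg hr] at h
      rwa [if_neg (by omega)]
  · induction s, hrs using Nat.le_induction with
    | base => exact h
    | succ s _ ih => rw [generic_decision_succ hc hp hpL, ih]

theorem generic_correct_leaders_card (hf : (L.filter (· ∈ faulty)).card ≤ t)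
    (hL : 3 * t + 1 ≤ L.card) : 2 * t + 1 ≤ (L.filter (· ∉ faulty)).card := by
  have := Finset.card_filter_add_card_filter_not (s := L) (· ∈ faulty)
  omega

/-- GENERIC solves consensus if at most `t` leaders are faulty, out of at least `3 * t + 1`. -/
theorem generic_isConsensus (hf : (L.filter (· ∈ faulty)).card ≤ t) (hL : 3 * t + 1 ≤ L.card)
    (hc : IsComputation (generic L t) faulty input state msg) :
    IsConsensus faulty input (fun r p => (generic L t).output (state r p)) (t + 2) := by
  have hT : ∀ p ∈ L, p ∉ faulty → ∀ j ∈ L, j ∉ faulty → ∀ x : List P, x.length ≤ t →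
      (state (t + 1) p).tree (j :: x) = (state (t + 1) j).tree x :=
    fun p hpL hp j hjL hj x hx => generic_tree_cons hc hp hpL hj hjL hx
  have hcard := generic_correct_leaders_card hf hL
  obtain ⟨p₀, hp₀⟩ : (L.filter (· ∉ faulty)).Nonempty := Finset.card_pos.1 (by omega)
  obtain ⟨hp₀L, hp₀f⟩ := Finset.mem_filter.1 hp₀
  obtain ⟨V, hV⟩ : ∃ V, resolve L (state (t + 1) p₀).tree (t + 1) [] = V := ⟨_, rfl⟩
  have hagree : ∀ p ∈ L, p ∉ faulty → resolve L (state (t + 1) p).tree (t + 1) [] = V :=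
    fun p hpL hp => hV ▸ resolve_agreement hf hL (T := fun p => (state (t + 1) p).tree) hT hpL hp
      hp₀L hp₀f (t + 1) [] (by simp) List.nodup_nil (by simp)
  have hvalid : ∀ v, (∀ p, p ∉ faulty → input p = v) → V = v := by
    intro v hv
    rw [← hV, resolve]
    refine majority_eq_of_correct hf hL (by simp) fun j hjL hj => ?_
    rw [resolve_cons_of_correct hf hL (T := fun p => (state (t + 1) p).tree) hT hp₀L hp₀f t []
      (by simp) j hjL hj, generic_tree_nil hc hj hjL, hv j hj]
  -- Only faulty leaders can announce a value other than `V`, in any round, so such a value never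
  -- collects more than `t` votes.
  have hvotes : ∀ p, p ∉ faulty → p ∉ L → ∀ v, v ≠ V → ∀ r,
      (state r p).votes v ⊆ L.filter (· ∈ faulty) := by
    intro p hp hpL v hv r
    induction r with
    | zero => rw [hc.start_eq p hp]; simp [generic]
    | succ r ih =>
      rw [generic_votes_succ hc hp hpL]
      refine Finset.union_subset ih fun j hj => ?_
      obtain ⟨hjL, hjv⟩ := Finset.mem_filter.1 hj
      refine Finset.mem_filter.2 ⟨hjL, by_contra fun hjf => ?_⟩
      rw [generic_announced hc hjf hjL, hagree j hjL hjf] at hjv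
      split_ifs at hjv
      exact hv (Option.some.inj hjv).symm
  have hdec : ∀ p, p ∉ faulty → ∀ r v, (state r p).decision = some v → v = V := by
    intro p hp r
    by_cases hpL : p ∈ L
    · intro v hv
      rw [generic_leader_decision hc hp hpL, hagree p hpL hp] at hv
      split_ifs at hv
      exact (Option.some.inj hv).symm
    · have hmany : ∀ r v, 2 * t + 1 ≤ ((state r p).votes v).card → v = V := by
        intro r v h
        by_contra hv
        have := Finset.card_le_card (hvotes p hp hpL v hv r)
        omega
      induction r with
      | zero => rw [hc.start_eq p hp]; simp [generic]
      | succ r ih =>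
        intro v hv
        rw [generic_decision_succ hc hp hpL] at hv
        split at hv
        · next w hw => exact ih v (hw.trans hv)
        · split_ifs at hv with h1 h2
          · exact Option.some.inj hv ▸ hmany _ _ h1
          · exact Option.some.inj hv ▸ hmany _ _ h2
  have hterm : ∀ p, p ∉ faulty → (state (t + 2) p).decision = some V := by
    intro p hp
    suffices h : ∃ v, (state (t + 2) p).decision = some v by
      obtain ⟨v, hv⟩ := h
      rw [hv, hdec p hp _ v hv]
    by_cases hpL : p ∈ L
    · exact ⟨_, (generic_leader_decision hc hp hpL _).trans (if_neg (by omega))⟩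
    · have hV' : 2 * t + 1 ≤ ((state (t + 1 + 1) p).votes V).card := by
        refine hcard.trans (Finset.card_le_card fun j hj => ?_)
        obtain ⟨hjL, hjf⟩ := Finset.mem_filter.1 hj
        rw [generic_votes_succ hc hp hpL]
        refine Finset.mem_union_right _ (Finset.mem_filter.2 ⟨hjL, ?_⟩)
        rw [generic_announced hc hjf hjL, if_pos rfl, hagree j hjL hjf]
      rw [generic_decision_succ hc hp hpL]
      split
      · exact ⟨_, rfl⟩
      -- It is enough that some value is adopted, since `hdec` identifies it as `V`. Hence the test
      -- for `true`, which comes first, need not be refuted when `V` is `false`.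
      · cases V
        · rw [if_pos hV']
          split_ifs
          exacts [⟨_, rfl⟩, ⟨_, rfl⟩]
        · exact ⟨_, if_pos hV'⟩
  refine ⟨fun p hp r s v hrs h => generic_irrevocable hc hp hrs h, ?_, ?_, ?_⟩
  · intro p q hp hq r s v w hv hw
    rw [hdec p hp r v hv, hdec q hq s w hw]
  · intro v hv p hp
    exact ⟨t + 2, hvalid v hv ▸ hterm p hp⟩
  · intro p hp
    exact ⟨t + 2, le_rfl, V, hterm p hp⟩

end Computation

/-! ### Leaders of a cover -/

/-- The positions as ordered by `leaderLE`. -/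
def leaderKey (u : Space3) : ℝ ×ₗ ℝ ×ₗ ℝ := toLex (u 1, toLex (u 0, u 2))

theorem leaderLE_iff (u v : Space3) : leaderLE u v ↔ leaderKey u ≤ leaderKey v := by
  simp only [leaderLE, leaderKey, Prod.Lex.toLex_le_toLex]

theorem leaderKey_injective : Function.Injective leaderKey := by
  intro u v h
  simp only [leaderKey, EmbeddingLike.apply_eq_iff_eq, Prod.mk.injEq] at h
  ext i
  fin_cases i
  exacts [h.2.1, h.1, h.2.2]

section Cover

variable {ι : Type} {N M : ℕ} {pos : Fin N → Space3} {cover : Finset ι} {region : ι → Set Space3}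

theorem exists_isLeader {A : Set Space3} (h : ∃ p, pos p ∈ A) : ∃ p, IsLeader pos A p := by
  classical
  obtain ⟨p, hp, hmin⟩ := (univ.filter fun p => pos p ∈ A).exists_min_image
    (fun p => leaderKey (pos p)) (h.imp fun p hp => by simpa using hp)
  refine ⟨p, by simpa using hp, fun q hq => (leaderLE_iff _ _).2 (hmin q (by simpa using hq))⟩

theorem IsLeader.eq (hpos : Function.Injective pos) {A : Set Space3} {p q : Fin N}
    (hp : IsLeader pos A p) (hq : IsLeader pos A q) : p = q :=
  hpos (leaderKey_injective (le_antisymm ((leaderLE_iff _ _).1 (hp.2 q hq.1))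
    ((leaderLE_iff _ _).1 (hq.2 p hp.1))))

theorem mem_leaders {p : Fin N} :
    p ∈ leaders pos cover region ↔ ∃ a ∈ cover, IsLeader pos (region a) p := by
  simp [leaders]

/-- A leader lies in its area and no process lies in two, so distinct areas have distinct leaders;
distinct positions make the leader of an area unique. -/
theorem card_leaders (hpos : Function.Injective pos)
    (hdisj : ∀ a ∈ cover, ∀ b ∈ cover, ∀ p, pos p ∈ region a → pos p ∈ region b → a = b)
    (hne : ∀ a ∈ cover, ∃ p, pos p ∈ region a) :
    (leaders pos cover region).card = cover.card := by
  choose ld hld using fun a ha => exists_isLeader (hne a ha)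
  symm
  refine Finset.card_bij (fun a ha => ld a ha) (fun a ha => mem_leaders.2 ⟨a, ha, hld a ha⟩) ?_ ?_
  · intro a ha b hb hab
    exact hdisj a ha b hb _ (hld a ha).1 (hab ▸ (hld b hb).1)
  · intro p hp
    obtain ⟨a, ha, hpa⟩ := mem_leaders.1 hp
    exact ⟨a, ha, (hld a ha).eq hpos hpa⟩

theorem mem_coveredProcesses {F : Fin M → Set Space3} {p : Fin N} :
    p ∈ coveredProcesses pos F ↔ ∃ i, pos p ∈ F i := by
  simp [coveredProcesses]

-- A covered leader lies both in some fault area and in the area it leads, so the fault area meets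
-- that cover area. Leaders are then counted on the subcover met by each fault area.
open Classical in
theorem card_covered_leaders_le (hpos : Function.Injective pos)
    (hdisj : ∀ a ∈ cover, ∀ b ∈ cover, ∀ p, pos p ∈ region a → pos p ∈ region b → a = b)
    (hne : ∀ a ∈ cover, ∃ p, pos p ∈ region a) {F : Fin M → Set Space3} {n : ℕ}
    (hF : ∀ i, (cover.filter fun a => ∃ p, pos p ∈ F i ∧ pos p ∈ region a).card ≤ n) :
    ((leaders pos cover region).filter (· ∈ coveredProcesses pos F)).card ≤ n * M := by
  have hsub : (leaders pos cover region).filter (· ∈ coveredProcesses pos F) ⊆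
      (univ : Finset (Fin M)).biUnion fun i =>
        leaders pos (cover.filter fun a => ∃ p, pos p ∈ F i ∧ pos p ∈ region a) region := by
    intro p hp
    obtain ⟨hpL, hpF⟩ := Finset.mem_filter.1 hp
    obtain ⟨a, ha, hpa⟩ := mem_leaders.1 hpL
    obtain ⟨i, hi⟩ := mem_coveredProcesses.1 hpF
    exact Finset.mem_biUnion.2 ⟨i, mem_univ i,
      mem_leaders.2 ⟨a, Finset.mem_filter.2 ⟨ha, p, hi, hpa.1⟩, hpa⟩⟩
  refine (Finset.card_le_card hsub).trans ?_
  have := Finset.card_biUnion_le_card_mul (univ : Finset (Fin M)) (fun i =>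
    leaders pos (cover.filter fun a => ∃ p, pos p ∈ F i ∧ pos p ∈ region a) region) n fun i _ => by
      rw [card_leaders hpos
        (fun a ha b hb => hdisj a (Finset.mem_filter.1 ha).1 b (Finset.mem_filter.1 hb).1)
        (fun a ha => hne a (Finset.mem_filter.1 ha).1)]
      exact hF i
  rwa [Finset.card_univ, Fintype.card_fin, mul_comm] at this

open Classical in
/-- GENERIC solves geoconsensus for any cover by nonempty disjoint areas of which each fault area
meets at most `n`. -/
theorem generic_solvesGeoconsensus (hpos : Function.Injective pos)
    (hdisj : ∀ a ∈ cover, ∀ b ∈ cover, ∀ p, pos p ∈ region a → pos p ∈ region b → a = b)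
    (hne : ∀ a ∈ cover, ∃ p, pos p ∈ region a) {F : Fin M → Set Space3} {n : ℕ}
    (hF : ∀ i, (cover.filter fun a => ∃ p, pos p ∈ F i ∧ pos p ∈ region a).card ≤ n)
    (hcard : 3 * (n * M) + 1 ≤ cover.card) :
    SolvesGeoconsensus (generic (leaders pos cover region) (n * M)) pos F (n * M + 2) := by
  intro faulty hfaulty input state msg hc
  refine generic_isConsensus ((Finset.card_le_card fun p hp => ?_).trans
    (card_covered_leaders_le hpos hdisj hne hF)) ((card_leaders hpos hdisj hne).symm ▸ hcard) hc
  obtain ⟨hpL, hpf⟩ := Finset.mem_filter.1 hp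
  exact Finset.mem_filter.2 ⟨hpL, hfaulty hpf⟩

-- Inclusion-exclusion: leaders and covered processes together number at most `N`, and at most `n *
-- M` processes are both.
open Classical in
theorem card_coveredProcesses_add_le (hpos : Function.Injective pos)
    (hdisj : ∀ a ∈ cover, ∀ b ∈ cover, ∀ p, pos p ∈ region a → pos p ∈ region b → a = b)
    (hne : ∀ a ∈ cover, ∃ p, pos p ∈ region a) {F : Fin M → Set Space3} {n : ℕ}
    (hF : ∀ i, (cover.filter fun a => ∃ p, pos p ∈ F i ∧ pos p ∈ region a).card ≤ n) :
    (coveredProcesses pos F).card + cover.card ≤ N + n * M := by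
  have h1 := card_covered_leaders_le hpos hdisj hne hF
  have h2 := card_leaders hpos hdisj hne
  have h3 := Finset.card_union_add_card_inter (leaders pos cover region) (coveredProcesses pos F)
  have h4 := (leaders pos cover region ∪ coveredProcesses pos F).card_le_univ
  rw [Finset.filter_mem_eq_inter] at h1
  rw [Fintype.card_fin] at h4
  omega

end Cover

/-! ### The greedy cover -/

theorem greedyAux_subset (ℓ : ℝ) (n : ℕ) (S : Finset ℝ) : greedyAux ℓ n S ⊆ S := by
  induction n generalizing S with
  | zero => simp [greedyAux]
  | succ n ih =>
    rw [greedyAux]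
    split_ifs with h
    · exact Finset.insert_subset (S.min'_mem h) ((ih _).trans (Finset.filter_subset _ _))
    · simp

theorem greedyAux_separated {ℓ : ℝ} (hℓ : 0 ≤ ℓ) {n : ℕ} {S : Finset ℝ} {x y : ℝ}
    (hx : x ∈ greedyAux ℓ n S) (hy : y ∈ greedyAux ℓ n S) (hxy : x < y) : x + ℓ < y := by
  induction n generalizing S with
  | zero => simp [greedyAux] at hx
  | succ n ih =>
    rw [greedyAux] at hx hy
    split_ifs at hx hy with h
    · have key : ∀ z ∈ greedyAux ℓ n (S.filter fun x => S.min' h + ℓ < x), S.min' h + ℓ < z :=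
        fun z hz => (Finset.mem_filter.1 (greedyAux_subset _ _ _ hz)).2
      rcases Finset.mem_insert.1 hx with rfl | hx <;> rcases Finset.mem_insert.1 hy with rfl | hy
      · exact absurd hxy (lt_irrefl _)
      · exact key y hy
      · have := key x hx
        linarith
      · exact ih hx hy
    · simp at hx

theorem greedyStarts_subset (ℓ : ℝ) (S : Finset ℝ) : greedyStarts ℓ S ⊆ S :=
  greedyAux_subset ℓ _ S

theorem greedyStarts_separated {ℓ : ℝ} (hℓ : 0 ≤ ℓ) {S : Finset ℝ} {x y : ℝ}
    (hx : x ∈ greedyStarts ℓ S) (hy : y ∈ greedyStarts ℓ S) (hxy : x < y) : x + ℓ < y :=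
  greedyAux_separated hℓ hx hy hxy

theorem greedyStarts_eq {ℓ : ℝ} (hℓ : 0 ≤ ℓ) {S : Finset ℝ} {x y u : ℝ}
    (hx : x ∈ greedyStarts ℓ S) (hy : y ∈ greedyStarts ℓ S) (hxu : x ≤ u ∧ u ≤ x + ℓ)
    (hyu : y ≤ u ∧ u ≤ y + ℓ) : x = y := by
  rcases lt_trichotomy x y with h | h | h
  · linarith [greedyStarts_separated hℓ hx hy h]
  · exact h
  · linarith [greedyStarts_separated hℓ hy hx h]

/-- A set of reals of diameter at most `k * ℓ` meets at most `k + 1` of the intervals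
`[x, x + ℓ]` whose starting points are more than `ℓ` apart. -/
theorem card_le_of_separated {ℓ : ℝ} (hℓ : 0 < ℓ) {S : Finset ℝ}
    (hS : ∀ x ∈ S, ∀ y ∈ S, x < y → x + ℓ < y) {I : Set ℝ} {k : ℕ}
    (hI : ∀ u ∈ I, ∀ v ∈ I, u - v ≤ k * ℓ)
    (hmeet : ∀ x ∈ S, ∃ u ∈ I, x ≤ u ∧ u ≤ x + ℓ) : S.card ≤ k + 1 := by
  rcases S.eq_empty_or_nonempty with rfl | hne
  · simp
  set m := S.min' hne with hm
  have hmS : m ∈ S := S.min'_mem hne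
  -- Measured in units of `ℓ` from the least start, distinct starts differ by more than 1 and so
  -- have distinct ceilings.
  have hinj : Set.InjOn (fun x => ⌈(x - m) / ℓ⌉₊) S := by
    have key : ∀ x ∈ S, ∀ y ∈ S, x < y → ⌈(x - m) / ℓ⌉₊ < ⌈(y - m) / ℓ⌉₊ := by
      intro x hx y hy hxy
      have h1 : 0 ≤ (x - m) / ℓ := div_nonneg (sub_nonneg.2 (S.min'_le x hx)) hℓ.le
      have h2 : (x - m) / ℓ + 1 < (y - m) / ℓ := by
        rw [div_add_one hℓ.ne', div_lt_div_iff_of_pos_right hℓ]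
        linarith [hS x hx y hy hxy]
      exact Nat.lt_ceil.2 ((Nat.ceil_lt_add_one h1).trans h2)
    intro x hx y hy hxy
    rcases lt_trichotomy x y with h | h | h
    · exact absurd hxy (key x hx y hy h).ne
    · exact h
    · exact absurd hxy (key y hy x hx h).ne'
  -- The value 1 is skipped because every start other than `m` exceeds `m + ℓ`; this gives `k + 1`
  -- rather than `k + 2`. The upper end holds since `x ≤ u` and `v ≤ m + ℓ` for points `u`, `v` of
  -- `I`.
  have hmaps : ∀ x ∈ S, ⌈(x - m) / ℓ⌉₊ ∈ insert 0 (Finset.Icc 2 (k + 1)) := by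
    intro x hx
    rcases (S.min'_le x hx).eq_or_lt with h | h
    · simp [← h, ← hm]
    · refine Finset.mem_insert_of_mem (Finset.mem_Icc.2 ⟨Nat.succ_le_of_lt (Nat.lt_ceil.2 ?_),
        Nat.ceil_le.2 ?_⟩)
      · rw [Nat.cast_one, one_lt_div hℓ]
        linarith [hS m hmS x hx h]
      · obtain ⟨u, hu, hu1, hu2⟩ := hmeet x hx
        obtain ⟨v, hv, hv1, hv2⟩ := hmeet m hmS
        rw [div_le_iff₀ hℓ]
        push_cast
        linarith [hI u hu v hv]
  refine (Finset.card_le_card_of_injOn _ hmaps hinj).trans ((Finset.card_insert_le _ _).trans ?_)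
  rw [Nat.card_Icc]
  omega

section Gcube

variable {N : ℕ} {ℓ : ℝ} {pos : Fin N → Space3}

open Classical in
noncomputable def slab (ℓ : ℝ) (pos : Fin N → Space3) (c : ℝ) : Finset (Fin N) :=
  univ.filter fun p => c ≤ pos p 2 ∧ pos p 2 ≤ c + ℓ

open Classical in
noncomputable def cuboid (ℓ : ℝ) (pos : Fin N → Space3) (c b : ℝ) : Finset (Fin N) :=
  (slab ℓ pos c).filter fun p => b ≤ pos p 1 ∧ pos p 1 ≤ b + ℓ

theorem mem_gcube {q : Space3} :
    q ∈ gcube ℓ pos ↔ q 2 ∈ greedyStarts ℓ (univ.image fun p => pos p 2) ∧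
      q 1 ∈ greedyStarts ℓ ((slab ℓ pos (q 2)).image fun p => pos p 1) ∧
      q 0 ∈ greedyStarts ℓ ((cuboid ℓ pos (q 2) (q 1)).image fun p => pos p 0) := by
  simp only [gcube, Finset.mem_biUnion, Finset.mem_image]
  constructor
  · rintro ⟨c, hc, b, hb, a, ha, rfl⟩
    exact ⟨hc, hb, ha⟩
  · rintro ⟨hc, hb, ha⟩
    refine ⟨q 2, hc, q 1, hb, q 0, ha, ?_⟩
    ext i
    fin_cases i <;> rfl

/-- The coordinates are compared in the order `z`, `y`, `x`: two `y`-starts belong to the same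
greedy run only once the slabs coincide, and likewise for `x`. -/
theorem gcube_disjoint (hℓ : 0 ≤ ℓ) {c d : Space3} (hc : c ∈ gcube ℓ pos) (hd : d ∈ gcube ℓ pos)
    {q : Space3} (hqc : q ∈ axisCube ℓ c) (hqd : q ∈ axisCube ℓ d) : c = d := by
  rw [mem_gcube] at hc hd
  have h2 : c 2 = d 2 := greedyStarts_eq hℓ hc.1 hd.1 (hqc 2) (hqd 2)
  rw [← h2] at hd
  have h1 : c 1 = d 1 := greedyStarts_eq hℓ hc.2.1 hd.2.1 (hqc 1) (hqd 1)
  rw [← h1] at hd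
  have h0 : c 0 = d 0 := greedyStarts_eq hℓ hc.2.2 hd.2.2 (hqc 0) (hqd 0)
  ext i
  fin_cases i
  exacts [h0, h1, h2]

/-- The least corner need not be a process, but its `x`-coordinate is that of a process in the same
cuboid, which therefore lies in the cube. -/
theorem exists_mem_of_mem_gcube (hℓ : 0 ≤ ℓ) {c : Space3} (hc : c ∈ gcube ℓ pos) :
    ∃ p, pos p ∈ axisCube ℓ c := by
  obtain ⟨p, hp, h0⟩ := Finset.mem_image.1 (greedyStarts_subset _ _ (mem_gcube.1 hc).2.2)
  simp only [cuboid, slab, Finset.mem_filter, Finset.mem_univ, true_and] at hp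
  refine ⟨p, fun i => ?_⟩
  fin_cases i
  · exact ⟨h0.ge, by simpa [← h0] using hℓ⟩
  · exact hp.2
  · exact hp.1

open Classical in
theorem card_greedyStarts_meeting_le (hℓ : 0 < ℓ) (S : Finset ℝ) {U : Set Space3} {k : ℕ}
    (hU : ∀ u ∈ U, ∀ v ∈ U, ∀ i, u i - v i ≤ k * ℓ) (i : Fin 3) :
    ((greedyStarts ℓ S).filter fun x => ∃ u ∈ U, x ≤ u i ∧ u i ≤ x + ℓ).card ≤ k + 1 := by
  refine card_le_of_separated hℓ (I := (fun u : Space3 => u i) '' U) (fun x hx y hy =>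
    greedyStarts_separated hℓ.le (Finset.mem_filter.1 hx).1 (Finset.mem_filter.1 hy).1) ?_ ?_
  · rintro _ ⟨u, hu, rfl⟩ _ ⟨v, hv, rfl⟩
    exact hU u hu v hv i
  · intro x hx
    obtain ⟨u, hu, h⟩ := (Finset.mem_filter.1 hx).2
    exact ⟨u i, ⟨u, hu, rfl⟩, h⟩

open Classical in
/-- A set whose extent along each axis is at most `k * ℓ` meets at most `(k + 1) ^ 3` cubes of the
greedy cover. -/
theorem card_gcube_meeting_le (hℓ : 0 < ℓ) {U : Set Space3} {k : ℕ}
    (hU : ∀ u ∈ U, ∀ v ∈ U, ∀ i, u i - v i ≤ k * ℓ) :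
    ((gcube ℓ pos).filter fun c => ∃ u ∈ U, u ∈ axisCube ℓ c).card ≤ (k + 1) ^ 3 := by
  -- The cuts in different slabs and cuboids are unrelated, so the cubes do not form a grid. Each
  -- greedy run still contributes at most `k + 1` choices, uniformly in the earlier ones.
  set Z : Finset ℝ := (greedyStarts ℓ (univ.image fun p => pos p 2)).filter
    fun x => ∃ u ∈ U, x ≤ u 2 ∧ u 2 ≤ x + ℓ with hZ
  set Y : ℝ → Finset ℝ := fun c => (greedyStarts ℓ ((slab ℓ pos c).image fun p => pos p 1)).filter
    fun x => ∃ u ∈ U, x ≤ u 1 ∧ u 1 ≤ x + ℓ with hY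
  set X : ℝ → ℝ → Finset ℝ := fun c b =>
    (greedyStarts ℓ ((cuboid ℓ pos c b).image fun p => pos p 0)).filter
      fun x => ∃ u ∈ U, x ≤ u 0 ∧ u 0 ≤ x + ℓ with hX
  have hsub : ((gcube ℓ pos).filter fun c => ∃ u ∈ U, u ∈ axisCube ℓ c) ⊆
      Z.biUnion fun c => (Y c).biUnion fun b => (X c b).image fun a => (!₂[a, b, c] : Space3) := by
    intro q hq
    obtain ⟨hq, u, hu, huq⟩ := Finset.mem_filter.1 hq
    obtain ⟨hc, hb, ha⟩ := mem_gcube.1 hq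
    refine Finset.mem_biUnion.2 ⟨q 2, Finset.mem_filter.2 ⟨hc, u, hu, huq 2⟩,
      Finset.mem_biUnion.2 ⟨q 1, Finset.mem_filter.2 ⟨hb, u, hu, huq 1⟩,
        Finset.mem_image.2 ⟨q 0, Finset.mem_filter.2 ⟨ha, u, hu, huq 0⟩, ?_⟩⟩⟩
    ext i
    fin_cases i <;> rfl
  calc _ ≤ _ := Finset.card_le_card hsub
    _ ≤ Z.card * ((k + 1) * (k + 1)) := Finset.card_biUnion_le_card_mul _ _ _ fun c _ =>
        (Finset.card_biUnion_le_card_mul _ _ (k + 1) fun b _ => Finset.card_image_le.trans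
          (card_greedyStarts_meeting_le hℓ _ hU 0)).trans
          (Nat.mul_le_mul_right _ (card_greedyStarts_meeting_le hℓ _ hU 1))
    _ ≤ (k + 1) * ((k + 1) * (k + 1)) :=
        Nat.mul_le_mul_right _ (card_greedyStarts_meeting_le hℓ _ hU 2)
    _ = (k + 1) ^ 3 := by ring

/-- The spheres may overlap, but cells inherit disjointness from the cubes, and within one cube a
point belongs only to its first sphere. -/
theorem sphereCell_disjoint (hℓ : 0 ≤ ℓ) {centers : Space3 → Fin 8 → Space3} {a b : Space3 × Fin 8}
    (ha : a ∈ gsphere ℓ pos centers) (hb : b ∈ gsphere ℓ pos centers) {q : Space3}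
    (hqa : q ∈ sphereCell ℓ centers a) (hqb : q ∈ sphereCell ℓ centers b) : a = b := by
  simp only [gsphere, Finset.mem_filter, Finset.mem_product] at ha hb
  obtain ⟨c, i⟩ := a
  obtain ⟨d, j⟩ := b
  obtain rfl : c = d := gcube_disjoint hℓ ha.1.1 hb.1.1 hqa.1 hqb.1
  rcases lt_trichotomy i j with h | rfl | h
  · exact absurd hqa.2.1 (hqb.2.2 i h)
  · rfl
  · exact absurd hqb.2.1 (hqa.2.2 j h)

-- Cells stay inside their cube, so the centers play no role: a set that meets a cell meets its
-- cube, and each cube has eight indices.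
open Classical in
theorem card_gsphere_meeting_le (hℓ : 0 < ℓ) (centers : Space3 → Fin 8 → Space3) {U : Set Space3}
    {k : ℕ} (hU : ∀ u ∈ U, ∀ v ∈ U, ∀ i, u i - v i ≤ k * ℓ) :
    ((gsphere ℓ pos centers).filter fun a => ∃ u ∈ U, u ∈ sphereCell ℓ centers a).card ≤
      (k + 1) ^ 3 * 8 := by
  have hsub : ((gsphere ℓ pos centers).filter fun a => ∃ u ∈ U, u ∈ sphereCell ℓ centers a) ⊆
      ((gcube ℓ pos).filter fun c => ∃ u ∈ U, u ∈ axisCube ℓ c) ×ˢ (univ : Finset (Fin 8)) := by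
    intro a ha
    obtain ⟨ha, u, hu, hua⟩ := Finset.mem_filter.1 ha
    simp only [gsphere, Finset.mem_filter, Finset.mem_product] at ha
    exact Finset.mem_product.2 ⟨Finset.mem_filter.2 ⟨ha.1.1, u, hu, hua.1⟩, Finset.mem_univ _⟩
  refine (Finset.card_le_card hsub).trans ?_
  rw [Finset.card_product, Finset.card_univ, Fintype.card_fin]
  exact Nat.mul_le_mul_right _ (card_gcube_meeting_le hℓ hU)

end Gcube

/-! ### The extent of the fault areas -/

theorem coord_sub_le_dist (u v : Space3) (i : Fin 3) : u i - v i ≤ dist u v := by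
  rw [dist_eq_norm]
  exact (le_abs_self _).trans (PiLp.norm_apply_le (u - v) i)

theorem IsAxisCube.extent_le {ℓ : ℝ} {F : Set Space3} (hF : IsAxisCube ℓ F) :
    ∀ u ∈ F, ∀ v ∈ F, ∀ i, u i - v i ≤ (1 : ℕ) * ℓ := by
  obtain ⟨c, rfl⟩ := hF
  intro u hu v hv i
  have := hu i
  have := hv i
  push_cast
  linarith

theorem IsSolidSphere.extent_le {ℓ : ℝ} {F : Set Space3} (hF : IsSolidSphere ℓ F) :
    ∀ u ∈ F, ∀ v ∈ F, ∀ i, u i - v i ≤ (1 : ℕ) * ℓ := by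
  obtain ⟨c, rfl⟩ := hF
  intro u hu v hv i
  have h1 := coord_sub_le_dist u v i
  have h2 := dist_triangle_right u v c
  rw [Metric.mem_closedBall] at hu hv
  push_cast
  linarith

/-- Isometries preserve the diagonal, and `3 * ℓ ^ 2 ≤ (2 * ℓ) ^ 2`. -/
theorem IsCube.extent_le {ℓ : ℝ} (hℓ : 0 ≤ ℓ) {F : Set Space3} (hF : IsCube ℓ F) :
    ∀ u ∈ F, ∀ v ∈ F, ∀ i, u i - v i ≤ (2 : ℕ) * ℓ := by
  obtain ⟨g, rfl⟩ := hF
  rintro _ ⟨x, hx, rfl⟩ _ ⟨y, hy, rfl⟩ i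
  refine (coord_sub_le_dist _ _ i).trans ?_
  rw [g.dist_eq, EuclideanSpace.dist_eq]
  refine Real.sqrt_le_iff.2 ⟨by positivity, ?_⟩
  have h : ∀ j, dist (x j) (y j) ^ 2 ≤ ℓ ^ 2 := by
    intro j
    have h1 := hx j
    have h2 := hy j
    simp only [PiLp.zero_apply, zero_add] at h1 h2
    exact pow_le_pow_left₀ dist_nonneg
      (by rw [Real.dist_eq, abs_sub_le_iff]; constructor <;> linarith) 2
  rw [Fin.sum_univ_three]
  push_cast
  nlinarith [h 0, h 1, h 2, sq_nonneg ℓ]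

/-! ### From overlap bounds to the thresholds on the cover -/

open Classical in
theorem gcube_solves {N M n m k : ℕ} {ℓ : ℝ} (hℓ : 0 < ℓ) {pos : Fin N → Space3}
    (hpos : Function.Injective pos) {F : Fin M → Set Space3}
    (hF : ∀ i, ∀ u ∈ F i, ∀ v ∈ F i, ∀ j, u j - v j ≤ k * ℓ) (hn : (k + 1) ^ 3 ≤ n)
    (hM : 1 ≤ M) (hnm : 2 * n + 1 ≤ m) (hcard : (n + m) * M ≤ (gcube ℓ pos).card) :
    SolvesGeoconsensus (genericCube ℓ pos n M) pos F (n * M + 2) ∧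
      (coveredProcesses pos F).card + m * M ≤ N := by
  have hdisj : ∀ a ∈ gcube ℓ pos, ∀ b ∈ gcube ℓ pos, ∀ p,
      pos p ∈ axisCube ℓ a → pos p ∈ axisCube ℓ b → a = b :=
    fun a ha b hb p => gcube_disjoint hℓ.le ha hb
  have hne := fun a (ha : a ∈ gcube ℓ pos) => exists_mem_of_mem_gcube hℓ.le ha
  have hmeet : ∀ i, ((gcube ℓ pos).filter fun a => ∃ p, pos p ∈ F i ∧ pos p ∈ axisCube ℓ a).card
      ≤ n := fun i => (Finset.card_le_card (Finset.monotone_filter_right _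
        fun a _ ⟨p, hp⟩ => ⟨pos p, hp⟩)).trans ((card_gcube_meeting_le hℓ (hF i)).trans hn)
  have := card_coveredProcesses_add_le hpos hdisj hne hmeet
  -- As `m ≥ 2 * n + 1` and `M ≥ 1`, the cover has at least `(3 * n + 1) * M ≥ 3 * (n * M) + 1`
  -- areas. Cancelling `n * M` in the counting bound gives the second claim.
  refine ⟨generic_solvesGeoconsensus hpos hdisj hne hmeet ?_, ?_⟩ <;> nlinarith

open Classical in
theorem gsphere_solves {N M n m k : ℕ} {ℓ : ℝ} (hℓ : 0 < ℓ) {pos : Fin N → Space3}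
    (hpos : Function.Injective pos) (centers : Space3 → Fin 8 → Space3) {F : Fin M → Set Space3}
    (hF : ∀ i, ∀ u ∈ F i, ∀ v ∈ F i, ∀ j, u j - v j ≤ k * ℓ) (hn : (k + 1) ^ 3 * 8 ≤ n)
    (hM : 1 ≤ M) (hnm : 2 * n + 1 ≤ m) (hcard : (n + m) * M ≤ (gsphere ℓ pos centers).card) :
    SolvesGeoconsensus (genericSphere ℓ pos centers n M) pos F (n * M + 2) ∧
      (coveredProcesses pos F).card + m * M ≤ N := by
  have hdisj : ∀ a ∈ gsphere ℓ pos centers, ∀ b ∈ gsphere ℓ pos centers, ∀ p,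
      pos p ∈ sphereCell ℓ centers a → pos p ∈ sphereCell ℓ centers b → a = b :=
    fun a ha b hb p => sphereCell_disjoint hℓ.le ha hb
  have hne : ∀ a ∈ gsphere ℓ pos centers, ∃ p, pos p ∈ sphereCell ℓ centers a :=
    fun a ha => (Finset.mem_filter.1 ha).2
  have hmeet : ∀ i, ((gsphere ℓ pos centers).filter
      fun a => ∃ p, pos p ∈ F i ∧ pos p ∈ sphereCell ℓ centers a).card ≤ n :=
    fun i => (Finset.card_le_card (Finset.monotone_filter_right _
      fun a _ ⟨p, hp⟩ => ⟨pos p, hp⟩)).trans ((card_gsphere_meeting_le hℓ centers (hF i)).trans hn)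
  have := card_coveredProcesses_add_le hpos hdisj hne hmeet
  refine ⟨generic_solvesGeoconsensus hpos hdisj hne hmeet ?_, ?_⟩ <;> nlinarith

theorem mainTheorem6 (N M : ℕ) (hM : 1 ≤ M) (ℓ : ℝ) (hℓ : 0 < ℓ)
    (pos : Fin N → Space3) (hpos : Function.Injective pos) :
    -- cubes in any orientation
    (82 * M ≤ (gcube ℓ pos).card →
      ∀ F : Fin M → Set Space3, (∀ i, IsCube ℓ (F i)) →
        SolvesGeoconsensus (genericCube ℓ pos 27 M) pos F (27 * M + 2) ∧
          (coveredProcesses pos F).card + 55 * M ≤ N) ∧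
    -- axis-aligned cubes
    (25 * M ≤ (gcube ℓ pos).card →
      ∀ F : Fin M → Set Space3, (∀ i, IsAxisCube ℓ (F i)) →
        SolvesGeoconsensus (genericCube ℓ pos 8 M) pos F (8 * M + 2) ∧
          (coveredProcesses pos F).card + 17 * M ≤ N) ∧
    -- spheres
    (∀ centers : Space3 → Fin 8 → Space3, IsSphereRefinement ℓ pos centers →
      325 * M ≤ (gsphere ℓ pos centers).card →
      ∀ F : Fin M → Set Space3, (∀ i, IsSolidSphere ℓ (F i)) →
        SolvesGeoconsensus (genericSphere ℓ pos centers 108 M) pos F (108 * M + 2) ∧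
          (coveredProcesses pos F).card + 217 * M ≤ N) := by

  refine ⟨fun hcard F hF => ?_, fun hcard F hF => ?_, fun centers _ hcard F hF => ?_⟩
  -- In all three cases `m = 2 * n + 1`. Here `n = 27 = (2 + 1) ^ 3`, and for aligned cubes `n = 8 =
  -- (1 + 1) ^ 3`.
  · exact gcube_solves hℓ hpos (fun i => (hF i).extent_le hℓ.le) (by norm_num) hM (by norm_num) hcard
  · exact gcube_solves hℓ hpos (fun i => (hF i).extent_le) (by norm_num) hM (by norm_num) hcard
  -- The count gives `(1 + 1) ^ 3 * 8 = 64`, well within the stated overlap bound 108.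
  · exact gsphere_solves hℓ hpos centers (fun i => (hF i).extent_le) (by norm_num) hM (by norm_num)
      hcard
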